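/- Let $M$ be a compact (Hausdorff, finite-dimensional) smooth manifold, possibly with boundary, and let $\sigma=(\sigma_t)_{t\in\mathbb R}$ be a non-trivial smooth flow on $M$. Let $C^\infty(M)=C^\infty(M,\mathbb R)$ carry the compact-open $C^\infty$-topology and the action $\alpha_t f=f\circ\sigma_t$ of $\mathbb R$, and for $s\in\mathbb R$ let $$\beta_s\colon C^\infty(M)\to C^\infty(M),\qquad \beta_s f=\int_0^1 f\circ\sigma_{us}\,du .$$ (1) If there is a point $p\in M$ whose orbit $\sigma_{\mathbb R}(p)$ is non-periodic (i.e. $\sigma_t(p)\neq p$ for all $t\neq 0$) and locally closed in $M$ (i.e. open in its closure), then $\beta_s$ is not surjective for Lebesgue-almost all $s\in\mathbb R$. (2) If there is a point $p\in M$ whose orbit closure $T=\overline{\sigma_{\mathbb R}(p)}$ is a torus on which the flow is linear, i.e. there are $d\ge 1$, $\theta\in\mathbb R^d$ and a homeomorphism $\iota\colon\mathbb T^d\to T$ with $\sigma_t(\iota(z))=\iota(e^{it\theta_1}z_1,\dots,e^{it\theta_d}z_d)$ for all $t\in\mathbb R$, $z\in\mathbb T^d$, then the set of $s>0$ for which $\beta_s$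 is not surjective is dense in $(0,\infty)$. Consequently, consider the Lie group $C^\infty(M)\rtimes_\alpha\mathbb R$, i.e. the space $C^\infty(M)\times\mathbb R$ with the product $(f,s)(g,t)=(f+\alpha_s g,\,s+t)$, with Lie algebra $C^\infty(M)\times\mathbb R$. It has a unique exponential function $\exp$, i.e. a unique map such that for each $x$ in the Lie algebra $t\mapsto\exp(tx)$ is a one-parameter group with derivative $x$ at $t=0$. If the hypothesis of (1) or that of (2) holds, then $\exp$ is not a local diffeomorphism at $0$: it does not restrict to a diffeomorphism (smooth in the sense of Bastiani, with smooth inverse) from an open neighbourhood of $0$ onto an open set. -/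

import Mathlib

open Set Filter Topology MeasureTheory
open scoped Manifold ContDiff

noncomputable section

/-! ### Integrals depending smoothly on a parameter -/

section ParametricIntegral

variable {E : Type*} [NormedAddCommGroup E] [NormedSpace ℝ E]
  {F : Type*} [NormedAddCommGroup F] [NormedSpace ℝ F]

theorem continuousOn_integral_unitInterval {E : Type*} [NormedAddCommGroup E] {s : Set E} {g : ℝ × E → F}
    (hg : ContinuousOn g (univ ×ˢ s)) :
    ContinuousOn (fun y => ∫ t in (0 : ℝ)..1, g (t, y)) s := by
  rw [continuousOn_iff_continuous_domRestrict]
  have h : Continuous (Function.uncurry fun (y : s) (t : ℝ) => g (t, (y : E))) := by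
    have : Continuous fun q : s × ℝ => (q.2, (q.1 : E)) := by fun_prop
    exact hg.comp_continuous this fun q => ⟨mem_univ _, q.1.2⟩
  exact intervalIntegral.continuous_parametric_intervalIntegral_of_continuous' h 0 1

theorem hasFDerivWithinAt_integral_unitInterval [CompleteSpace F] {s : Set E} (hs : Convex ℝ s)
    {g : ℝ × E → F} {g' : ℝ × E → E →L[ℝ] F}
    (hg : ContinuousOn g (univ ×ˢ s)) (hg' : ContinuousOn g' (univ ×ˢ s))
    (hd : ∀ t, ∀ y ∈ s, HasFDerivWithinAt (fun z => g (t, z)) (g' (t, y)) s y)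
    {x : E} (hx : x ∈ s) :
    HasFDerivWithinAt (fun y => ∫ t in (0 : ℝ)..1, g (t, y))
      (∫ t in (0 : ℝ)..1, g' (t, x)) s x := by
  have cg : ∀ y ∈ s, Continuous fun t => g (t, y) := fun y hy =>
    hg.comp_continuous (by fun_prop) fun t => ⟨mem_univ _, hy⟩
  have cg' : ∀ y ∈ s, Continuous fun t => g' (t, y) := fun y hy =>
    hg'.comp_continuous (by fun_prop) fun t => ⟨mem_univ _, hy⟩
  rw [hasFDerivWithinAt_iff_isLittleO, Asymptotics.isLittleO_iff]
  intro ε hε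
  have key : ∀ᶠ y : s in 𝓝 (⟨x, hx⟩ : s), ∀ t ∈ Icc (0 : ℝ) 1,
      ‖g' (t, (y : E)) - g' (t, x)‖ < ε := by
    apply isCompact_Icc.eventually_forall_of_forall_eventually
    intro t _
    have hc : Continuous fun q : s × ℝ => ‖g' (q.2, (q.1 : E)) - g' (q.2, x)‖ := by
      refine Continuous.norm (Continuous.sub ?_ ?_)
      · exact hg'.comp_continuous (by fun_prop) fun q => ⟨mem_univ _, q.1.2⟩
      · exact (cg' x hx).comp continuous_snd
    exact hc.continuousAt.eventually_lt continuousAt_const (by simpa using hε)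
  have key2 : ∀ᶠ y in 𝓝[s] x, ∀ t ∈ Icc (0 : ℝ) 1, ‖g' (t, y) - g' (t, x)‖ < ε := by
    rw [nhdsWithin_eq_map_subtype_coe hx]
    exact key
  obtain ⟨δ, hδ, hball⟩ := Metric.mem_nhdsWithin_iff.1 key2
  filter_upwards [inter_mem_nhdsWithin s (Metric.ball_mem_nhds x hδ)] with y hy
  have hconv : Convex ℝ (Metric.ball x δ ∩ s) := (convex_ball x δ).inter hs
  have hpt : ∀ t ∈ Icc (0 : ℝ) 1,
      ‖g (t, y) - g (t, x) - g' (t, x) (y - x)‖ ≤ ε * ‖y - x‖ := by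
    intro t ht
    exact hconv.norm_image_sub_le_of_norm_hasFDerivWithin_le' (f := fun z => g (t, z))
      (f' := fun z => g' (t, z)) (φ := g' (t, x))
      (fun z hz => (hd t z hz.2).mono inter_subset_right)
      (fun z hz => (hball hz t ht).le) ⟨Metric.mem_ball_self hδ, hx⟩ ⟨hy.2, hy.1⟩
  have e1 : (∫ t in (0 : ℝ)..1, g' (t, x)) (y - x) = ∫ t in (0 : ℝ)..1, g' (t, x) (y - x) :=
    ContinuousLinearMap.intervalIntegral_apply ((cg' x hx).intervalIntegrable 0 1) (y - x)
  have c3 : Continuous fun t => g' (t, x) (y - x) := (cg' x hx).clm_apply continuous_const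
  have c4 : Continuous fun t => g (t, y) - g (t, x) := (cg y hy.1).sub (cg x hx)
  rw [e1, ← intervalIntegral.integral_sub ((cg y hy.1).intervalIntegrable 0 1)
    ((cg x hx).intervalIntegrable 0 1), ← intervalIntegral.integral_sub
    (c4.intervalIntegrable 0 1) (c3.intervalIntegrable 0 1)]
  have := intervalIntegral.norm_integral_le_of_norm_le_const (a := (0 : ℝ)) (b := 1)
    (f := fun t => g (t, y) - g (t, x) - g' (t, x) (y - x)) (C := ε * ‖y - x‖)
    (fun t ht => hpt t (by
      rw [uIoc_of_le zero_le_one] at ht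
      exact ⟨ht.1.le, ht.2⟩))
  simpa using this

theorem contDiffOn_integral_unitInterval [CompleteSpace F] {s : Set E} (hs : Convex ℝ s)
    (hu : UniqueDiffOn ℝ s) {g : ℝ × E → F} (hg : ContDiffOn ℝ ∞ g (univ ×ˢ s)) :
    ContDiffOn ℝ ∞ (fun y => ∫ t in (0 : ℝ)..1, g (t, y)) s := by
  have hT := hg.ftaylorSeriesWithin (uniqueDiffOn_univ.prod hu)
  let p := ftaylorSeriesWithin ℝ g (univ ×ˢ s)
  let L : E →L[ℝ] ℝ × E := ContinuousLinearMap.inr ℝ ℝ E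
  let Φ : ∀ m : ℕ, ((ℝ × E) [×m]→L[ℝ] F) →L[ℝ] (E [×m]→L[ℝ] F) := fun m =>
    ContinuousMultilinearMap.compContinuousLinearMapL (fun _ => L)
  let q : ∀ m : ℕ, ℝ × E → (E [×m]→L[ℝ] F) := fun m z => Φ m (p z m)
  have hq : ∀ m : ℕ, ContinuousOn (q m) (univ ×ˢ s) := fun m =>
    (Φ m).continuous.comp_continuousOn (hT.cont m (by exact_mod_cast le_top))
  have hqd : ∀ (m : ℕ) (t : ℝ), ∀ y ∈ s,
      HasFDerivWithinAt (fun z => q m (t, z)) (q (m + 1) (t, y)).curryLeft s y := by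
    intro m t y hy
    have h1 := hT.fderivWithin m (by exact_mod_cast WithTop.coe_lt_top m) (t, y)
      ⟨mem_univ _, hy⟩
    have h2 : HasFDerivWithinAt (fun z : E => (t, z)) L s y :=
      (hasFDerivAt_prodMk_right t y).hasFDerivWithinAt
    have h3 := h1.comp y h2 (fun z hz => ⟨mem_univ _, hz⟩)
    have h4 := ((Φ m).hasFDerivAt (x := p (t, y) m)).comp_hasFDerivWithinAt y h3
    refine h4.congr_fderiv ?_
    ext v w
    simp only [ContinuousLinearMap.comp_apply, ContinuousMultilinearMap.curryLeft_apply, q, Φ,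
      ContinuousMultilinearMap.compContinuousLinearMapL_apply,
      ContinuousMultilinearMap.compContinuousLinearMap_apply, p]
    congr 1
    ext i : 1
    refine Fin.cases ?_ (fun j => ?_) i <;> simp
  have hint : ∀ m : ℕ, ∀ y ∈ s, IntervalIntegrable (fun t => q m (t, y)) volume 0 1 :=
    fun m y hy => ((hq m).comp_continuous (f := fun t : ℝ => (t, y)) (by fun_prop)
      fun t => ⟨mem_univ _, hy⟩).intervalIntegrable 0 1
  have hR : HasFTaylorSeriesUpToOn ∞ (fun y => ∫ t in (0 : ℝ)..1, g (t, y))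
      (fun y m => ∫ t in (0 : ℝ)..1, q m (t, y)) s := by
    refine ⟨?_, ?_, ?_⟩
    · intro y hy
      have := (ContinuousMultilinearMap.apply ℝ (fun _ : Fin 0 => E) F 0).intervalIntegral_comp_comm
        (hint 0 y hy)
      refine this.symm.trans ?_
      refine intervalIntegral.integral_congr fun t _ => ?_
      have h0 := hT.zero_eq (t, y) ⟨mem_univ _, hy⟩
      change (q 0 (t, y)) 0 = g (t, y)
      rw [← h0]
      simp only [q, Φ, p, ContinuousMultilinearMap.curry0,
        ContinuousMultilinearMap.compContinuousLinearMapL_apply,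
        ContinuousMultilinearMap.compContinuousLinearMap_apply]
      congr 1
    · intro m _ y hy
      let C := (continuousMultilinearCurryLeftEquiv ℝ (fun _ : Fin (m + 1) => E)
          F).toContinuousLinearEquiv.toContinuousLinearMap
      have hC : ∀ φ, C φ = φ.curryLeft := fun _ => rfl
      clear_value C
      have h1 := hasFDerivWithinAt_integral_unitInterval hs (hq m)
        (C.continuous.comp_continuousOn (hq (m + 1)))
        (fun t y hy => (hqd m t y hy).congr_fderiv (hC _).symm) hy
      refine h1.congr_fderiv ?_
      refine Eq.trans ?_ (hC _)
      exact ContinuousLinearMap.intervalIntegral_comp_comm (𝕜 := ℝ) (E := E [×(m + 1)]→L[ℝ] F)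
        (F := E →L[ℝ] (E [×m]→L[ℝ] F)) C (hint (m + 1) y hy)
    · intro m _
      exact continuousOn_integral_unitInterval (hq m)
  exact hR.contDiffOn

end ParametricIntegral

/-! ### The space `C^∞(M)` with the compact-open `C^∞`-topology -/

section SmoothFunctions

variable {E : Type*} [NormedAddCommGroup E] [NormedSpace ℝ E]
  {H : Type*} [TopologicalSpace H] {I : ModelWithCorners ℝ E H}
  {M : Type*} [TopologicalSpace M] [ChartedSpace H M]

/-- The `k`-th derivative of `f` read in the chart at `x`, as a function on the model space, in
the space of functions with the topology of uniform convergence on the compact subsets of the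
domain of the (inverse) chart. -/
def chartDeriv (x : M) (k : ℕ) (f : C^∞⟮I, M; 𝓘(ℝ, ℝ), ℝ⟯) :
    UniformOnFun E (E [×k]→L[ℝ] ℝ) {K : Set E | IsCompact K ∧ K ⊆ (extChartAt I x).target} :=
  UniformOnFun.ofFun {K : Set E | IsCompact K ∧ K ⊆ (extChartAt I x).target}
    (iteratedFDerivWithin ℝ k (f ∘ (extChartAt I x).symm) (extChartAt I x).target)

/-- The compact-open `C^∞`-topology on `C^∞(M)`: uniform convergence of all derivatives in charts
on compact sets. -/
instance smoothFunctionsTopology : TopologicalSpace C^∞⟮I, M; 𝓘(ℝ, ℝ), ℝ⟯ :=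
  ⨅ (x : M) (k : ℕ), TopologicalSpace.induced (chartDeriv x k) inferInstance

end SmoothFunctions

/-! ### Calculus in locally convex spaces -/

section Bastiani

variable {V : Type*} [AddCommGroup V] [Module ℝ V] [TopologicalSpace V]
  {W : Type*} [AddCommGroup W] [Module ℝ W] [TopologicalSpace W]

/-- `f` has the directional derivative `w` at `x` in the direction `v`. -/
def HasDirDerivAt (f : V → W) (w : W) (x v : V) : Prop :=
  Tendsto (fun t : ℝ => t⁻¹ • (f (x + t • v) - f x)) (𝓝[≠] 0) (𝓝 w)

/-- `f` is smooth on the open set `U` in the sense of Bastiani: all iterated directional derivatives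
`D k x (v₁, …, v_k)` exist at the points of `U` and are continuous on `U × V ^ k`. -/
def BastianiSmoothOn (f : V → W) (U : Set V) : Prop :=
  IsOpen U ∧ ∃ D : (k : ℕ) → V → (Fin k → V) → W,
    (∀ x ∈ U, ∀ v, D 0 x v = f x) ∧
    (∀ (k : ℕ), ∀ x ∈ U, ∀ (v : Fin k → V) (w : V),
      HasDirDerivAt (fun y => D k y v) (D (k + 1) x (Fin.snoc v w)) x w) ∧
    ∀ k : ℕ, ContinuousOn (fun q : V × (Fin k → V) => D k q.1 q.2) (U ×ˢ univ)

/-- `f` restricts to a diffeomorphism from an open neighbourhood of `x` onto an open set. -/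
def IsLocalDiffeoAt (f : V → W) (x : V) : Prop :=
  ∃ (U : Set V) (U' : Set W) (g : W → V), x ∈ U ∧ MapsTo f U U' ∧ MapsTo g U' U ∧
    LeftInvOn g f U ∧ RightInvOn g f U' ∧ BastianiSmoothOn f U ∧ BastianiSmoothOn g U'

end Bastiani

/-! ### Smooth flows and their averaging operators -/

/-- A smooth flow `σ : ℝ × M → M` on a manifold. -/
structure SmoothFlow {E : Type*} [NormedAddCommGroup E] [NormedSpace ℝ E]
    {H : Type*} [TopologicalSpace H] (I : ModelWithCorners ℝ E H)
    (M : Type*) [TopologicalSpace M] [ChartedSpace H M] extends Flow ℝ M where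
  contMDiff_toFun : ContMDiff (𝓘(ℝ, ℝ).prod I) I ∞ (fun q : ℝ × M => toFun q.1 q.2)

namespace SmoothFlow

variable {E : Type*} [NormedAddCommGroup E] [NormedSpace ℝ E]
  {H : Type*} [TopologicalSpace H] {I : ModelWithCorners ℝ E H}
  {M : Type*} [TopologicalSpace M] [ChartedSpace H M] (σ : SmoothFlow I M)

/-- Some point is moved. -/
def Nontrivial : Prop := ∃ t p, σ.toFlow t p ≠ p

/-- There is a locally closed orbit whose orbit map has no nonzero period (in particular the orbit
is not a fixed point). -/
def HasNonperiodicLocallyClosedOrbit : Prop :=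
  ∃ p : M, (∀ t : ℝ, t ≠ 0 → σ.toFlow t p ≠ p) ∧ IsLocallyClosed (σ.toFlow.orbit p)

/-- Some orbit closure is a torus `ι(𝕋^d)`, `d ≥ 1`, on which the flow is the linear flow
`z ↦ (exp(i t θ_j) z_j)_j`. As `𝕋^d` is compact, `ι` is a homeomorphism onto its image when `M` is
Hausdorff; smooth embeddings are included. -/
def HasLinearTorusOrbitClosure : Prop :=
  ∃ (p : M) (d : ℕ) (θ : Fin d → ℝ) (ι : (Fin d → Circle) → M), 0 < d ∧
    Continuous ι ∧ Function.Injective ι ∧ range ι = closure (σ.toFlow.orbit p) ∧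
    ∀ (t : ℝ) (z : Fin d → Circle),
      σ.toFlow t (ι z) = ι (fun j => Circle.exp (t * θ j) * z j)

theorem contMDiff_apply (t : ℝ) : ContMDiff I I ∞ (fun p => σ.toFlow t p) :=
  σ.contMDiff_toFun.comp (contMDiff_const.prodMk contMDiff_id)

/-- The action `α_t f = f ∘ σ_t` on `C^∞(M)`. -/
def pullback (t : ℝ) : C^∞⟮I, M; 𝓘(ℝ, ℝ), ℝ⟯ ≃+ C^∞⟮I, M; 𝓘(ℝ, ℝ), ℝ⟯ where
  toFun f := ⟨fun p => f (σ.toFlow t p), f.contMDiff.comp (σ.contMDiff_apply t)⟩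
  invFun f := ⟨fun p => f (σ.toFlow (-t) p), f.contMDiff.comp (σ.contMDiff_apply (-t))⟩
  left_inv f := by
    ext p
    change f (σ.toFlow t (σ.toFlow (-t) p)) = f p
    rw [← Flow.map_add]
    simp
  right_inv f := by
    ext p
    change f (σ.toFlow (-t) (σ.toFlow t p)) = f p
    rw [← Flow.map_add]
    simp
  map_add' _ _ := rfl

theorem continuous_integrand (s : ℝ) (f : C^∞⟮I, M; 𝓘(ℝ, ℝ), ℝ⟯) (p : M) :
    Continuous fun u : ℝ => f (σ.toFlow (u * s) p) :=
  f.contMDiff.continuous.comp (by fun_prop)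

theorem contMDiff_average [IsManifold I ∞ M] (s : ℝ) (f : C^∞⟮I, M; 𝓘(ℝ, ℝ), ℝ⟯) :
    ContMDiff I 𝓘(ℝ, ℝ) ∞ (fun p => ∫ u in (0 : ℝ)..1, f (σ.toFlow (u * s) p)) := by
  intro x
  rw [contMDiffAt_iff_source, contMDiffWithinAt_iff_contDiffWithinAt]
  obtain ⟨δ, hδ, hball⟩ :=
    Metric.mem_nhdsWithin_iff.1 (extChartAt_target_mem_nhdsWithin (I := I) x)
  let S : Set E := range I ∩ Metric.ball (extChartAt I x x) δ
  have hST : S ⊆ (extChartAt I x).target := fun y hy => hball ⟨hy.2, hy.1⟩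
  have hconv : Convex ℝ S := I.convex_range.inter (convex_ball _ _)
  have huniq : UniqueDiffOn ℝ S := I.uniqueDiffOn.inter Metric.isOpen_ball
  have hg : ContDiffOn ℝ ∞ (fun q : ℝ × E =>
      f (σ.toFlow (q.1 * s) ((extChartAt I x).symm q.2))) (univ ×ˢ S) := by
    rw [← contMDiffOn_iff_contDiffOn, modelWithCornersSelf_prod, ← chartedSpaceSelf_prod]
    have h1 : ContMDiffOn (𝓘(ℝ, ℝ).prod 𝓘(ℝ, E)) (𝓘(ℝ, ℝ).prod I) ∞
        (fun q : ℝ × E => (q.1 * s, (extChartAt I x).symm q.2)) (univ ×ˢ S) := by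
      refine ContMDiffOn.prodMk ?_ ?_
      · exact ((contDiff_id.mul contDiff_const).contMDiff (E := ℝ) (E' := ℝ)
          (f := fun r : ℝ => r * s)).comp_contMDiffOn contMDiffOn_fst
      · exact (contMDiffOn_extChartAt_symm x).comp contMDiffOn_snd fun q hq => hST hq.2
    exact (f.contMDiff.comp σ.contMDiff_toFun).comp_contMDiffOn h1
  have h := contDiffOn_integral_unitInterval hconv huniq hg
  have hx : extChartAt I x x ∈ S := ⟨mem_range_self _, Metric.mem_ball_self hδ⟩
  exact (h _ hx).mono_of_mem_nhdsWithin
    (inter_mem_nhdsWithin _ (Metric.ball_mem_nhds _ hδ))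

/-- The averaging operator `β_s f = ∫₀¹ f ∘ σ_{us} du` on `C^∞(M)`; for `s ≠ 0` it equals
`s⁻¹ ∫₀ˢ f ∘ σ_u du`. -/
def average [IsManifold I ∞ M] (s : ℝ) :
    C^∞⟮I, M; 𝓘(ℝ, ℝ), ℝ⟯ →ₗ[ℝ] C^∞⟮I, M; 𝓘(ℝ, ℝ), ℝ⟯ where
  toFun f := ⟨fun p => ∫ u in (0 : ℝ)..1, f (σ.toFlow (u * s) p), σ.contMDiff_average s f⟩
  map_add' f g := by
    ext p
    exact intervalIntegral.integral_add ((σ.continuous_integrand s f p).intervalIntegrable 0 1)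
      ((σ.continuous_integrand s g p).intervalIntegrable 0 1)
  map_smul' c f := by
    ext p
    exact intervalIntegral.integral_const_mul c fun u => f (σ.toFlow (u * s) p)

/-! ### The semidirect product and its exponential function -/

/-- The homomorphism `t ↦ α_t` from `(ℝ, +)` to the automorphisms of `(C^∞(M), +)`. -/
def action : Multiplicative ℝ →* MulAut (Multiplicative C^∞⟮I, M; 𝓘(ℝ, ℝ), ℝ⟯) where
  toFun t := AddEquiv.toMultiplicative (σ.pullback t.toAdd)
  map_one' := by
    ext f : 1
    apply Multiplicative.toAdd.injective
    ext p
    exact congrArg f.toAdd (σ.toFlow.map_zero_apply p)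
  map_mul' s t := by
    ext f : 1
    apply Multiplicative.toAdd.injective
    ext p
    change f.toAdd (σ.toFlow (s.toAdd + t.toAdd) p) =
      f.toAdd (σ.toFlow t.toAdd (σ.toFlow s.toAdd p))
    rw [← Flow.map_add, add_comm]

/-- The group `C^∞(M) ⋊_α ℝ`, with product `(f, s) (g, t) = (f + α_s g, s + t)`. -/
abbrev SemidirectGroup : Type _ :=
  Multiplicative C^∞⟮I, M; 𝓘(ℝ, ℝ), ℝ⟯ ⋊[σ.action] Multiplicative ℝ

/-- The global chart `C^∞(M) ⋊_α ℝ → C^∞(M) × ℝ` that defines the Lie group structure. It also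
identifies the tangent space at the unit, the Lie algebra, with `C^∞(M) × ℝ`. -/
def groupChart (g : σ.SemidirectGroup) : C^∞⟮I, M; 𝓘(ℝ, ℝ), ℝ⟯ × ℝ :=
  (g.left.toAdd, g.right.toAdd)

/-- `e` is the exponential function of `C^∞(M) ⋊_α ℝ`: for every element `x` of the Lie algebra
the curve `t ↦ e (t x)` is a one-parameter group with derivative `x` at `t = 0`. (Smoothness is not
demanded of `e`, as these conditions already determine it.) -/
def IsExponentialFunction (e : C^∞⟮I, M; 𝓘(ℝ, ℝ), ℝ⟯ × ℝ → σ.SemidirectGroup) : Prop :=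
  ∀ x, (∀ s t : ℝ, e ((s + t) • x) = e (s • x) * e (t • x)) ∧
    HasDirDerivAt (fun y => σ.groupChart (e y)) x 0 x

end SmoothFlow

end

/-!
The averaging operator `β_s` damps oscillations of period `s`, and each hypothesis on the flow
turns this into an obstruction to surjectivity.

*Nonperiodic orbits.* A locally closed nonperiodic orbit is embedded (Baire), so there is a smooth
bump `f` on `M` which along the orbit is supported in a short time interval. If `β_s g = f`, let
`G q = ∫₀¹ g (σ_{us} q) exp (-2πiu) du`, which is continuous on `M`. Then
`t ↦ G (σ_t p) exp (-2πit/s)` is constant on either side of the support of the bump, and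
integration by parts shows that the two constants differ by a multiple of the Fourier coefficient of
the bump at frequency `1/s`, which is nonzero when the interval is short compared with `s`
(`fourier_average_of_bump`). So one of them is nonzero, and a multiple of
`G` is `exp (2πit/s)` along one end of the orbit. Continuous functions on `M` with this
property at the same end, for different `s`, have uniform distance at least `1`, and `C(M, ℂ)` is separable, so only
countably many `s` occur (`countable_setOf_asymptotic_frequency`).

*Tori.* The image of `β_s`, restricted to the torus, has vanishing Fourier coefficient at each
character whose frequency is a nonzero multiple of `2π/s`. Powers of one coordinate suffice to reach a
dense set of `s`, and a bump function has nonzero coefficient.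

*The exponential function* is `(f, s) ↦ (β_s f, s)`: uniqueness is a pointwise differential equation,
and existence needs that `t ↦ β_{ts} f` is continuous into `C^∞(M)`, which follows from joint
smoothness in `t` and the point. Since this map preserves `s`, an open image around `0` would contain
`(t w, s)` for every `w` and small `t ≠ 0`, so that `β_s` would be surjective for all small `s`.
-/

/-! ### Curves in `C^∞(M)` -/

section Curves

open scoped Pointwise

variable {E : Type*} [NormedAddCommGroup E] [NormedSpace ℝ E]
  {H : Type*} [TopologicalSpace H] {I : ModelWithCorners ℝ E H}
  {M : Type*} [TopologicalSpace M] [ChartedSpace H M]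

/-- The partial derivatives in `y` of a smooth function of `(t, y)` are jointly continuous: they
are the restrictions of the full derivatives to the second factor. -/
theorem continuousOn_iteratedFDerivWithin_slice {F : Type*} [NormedAddCommGroup F]
    [NormedSpace ℝ F] {s : Set E} (hs : UniqueDiffOn ℝ s)
    {g : ℝ × E → F} (hg : ContDiffOn ℝ ∞ g (univ ×ˢ s)) (k : ℕ) :
    ContinuousOn (fun q : ℝ × E => iteratedFDerivWithin ℝ k (fun y => g (q.1, y)) s q.2)
      (univ ×ˢ s) := by
  let L : E →L[ℝ] ℝ × E := ContinuousLinearMap.inr ℝ ℝ E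
  have key : ∀ q ∈ univ ×ˢ s, iteratedFDerivWithin ℝ k (fun y => g (q.1, y)) s q.2 =
      ContinuousMultilinearMap.compContinuousLinearMapL (fun _ => L)
        (iteratedFDerivWithin ℝ k g (univ ×ˢ s) q) := by
    rintro ⟨t, y⟩ ⟨-, hy⟩
    have hpre : (fun z : ℝ × E => (t, (0 : E)) + z) ⁻¹' (univ ×ˢ s) = univ ×ˢ s := by
      ext z; simp
    have htrans : ContDiffOn ℝ ∞ (fun z : ℝ × E => g ((t, 0) + z)) (univ ×ˢ s) :=
      hg.comp (contDiff_const.add contDiff_id).contDiffOn fun z hz => by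
        simpa using hz
    have hLs : L ⁻¹' (univ ×ˢ s) = s := by ext z; simp [L]
    have h1 := ContinuousLinearMap.iteratedFDerivWithin_comp_right L htrans
      (uniqueDiffOn_univ.prod hs) (x := y) (by rw [hLs]; exact hs) (by simpa [L] using hy)
      (i := k) (by exact_mod_cast le_top)
    rw [hLs] at h1
    have h2 := iteratedFDerivWithin_comp_add_left (𝕜 := ℝ) (f := g) (s := univ ×ˢ s) k (t, (0 : E))
      (L y)
    have hsm : (t, (0 : E)) +ᵥ (univ ×ˢ s : Set (ℝ × E)) = univ ×ˢ s := by
      ext z; simp [Set.mem_vadd_set_iff_neg_vadd_mem]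
    rw [hsm] at h2
    rw [h2] at h1
    have e1 : ((fun z : ℝ × E => g ((t, 0) + z)) ∘ L) = fun y => g (t, y) := by
      ext z; simp [L]
    rw [e1] at h1
    rw [h1]
    simp [L]
  refine ContinuousOn.congr ?_ key
  exact (ContinuousLinearMap.continuous _).comp_continuousOn
    (hg.continuousOn_iteratedFDerivWithin (by exact_mod_cast le_top)
      (uniqueDiffOn_univ.prod hs))

/-- A smooth function of `(t, p)` is a continuous curve `t ↦ F (t, ·)` in `C^∞(M)`. -/
theorem continuous_curve_of_contMDiff [IsManifold I ∞ M] (γ : ℝ → C^∞⟮I, M; 𝓘(ℝ, ℝ), ℝ⟯)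
    (hγ : ContMDiff (𝓘(ℝ, ℝ).prod I) 𝓘(ℝ, ℝ) ∞ fun q : ℝ × M => γ q.1 q.2) :
    Continuous γ := by
  refine continuous_iInf_rng.2 fun x => continuous_iInf_rng.2 fun k => continuous_induced_rng.2 ?_
  have hg : ContDiffOn ℝ ∞ (fun q : ℝ × E => γ q.1 ((extChartAt I x).symm q.2))
      (univ ×ˢ (extChartAt I x).target) := by
    rw [← contMDiffOn_iff_contDiffOn, modelWithCornersSelf_prod, ← chartedSpaceSelf_prod]
    have h1 : ContMDiffOn (𝓘(ℝ, ℝ).prod 𝓘(ℝ, E)) (𝓘(ℝ, ℝ).prod I) ∞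
        (fun q : ℝ × E => (q.1, (extChartAt I x).symm q.2))
        (univ ×ˢ (extChartAt I x).target) :=
      contMDiffOn_fst.prodMk
        ((contMDiffOn_extChartAt_symm x).comp contMDiffOn_snd fun q hq => hq.2)
    exact hγ.comp_contMDiffOn h1
  have hc := continuousOn_iteratedFDerivWithin_slice (uniqueDiffOn_extChartAt_target x) hg k
  rw [continuous_iff_continuousAt]
  intro t₀
  refine UniformOnFun.tendsto_iff_tendstoUniformlyOn.2 fun K hK u hu => ?_
  obtain ⟨v, hv, hvu⟩ := IsCompact.mem_uniformity_of_prod (s := univ)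
    (f := fun (t : ℝ) (y : E) => iteratedFDerivWithin ℝ k
      (fun y => γ t ((extChartAt I x).symm y)) (extChartAt I x).target y) hK.1
    (hc.mono (prod_mono_right hK.2)) (mem_univ t₀) (symm_le_uniformity hu)
  rw [nhdsWithin_univ] at hv
  filter_upwards [hv] with t ht y hy
  exact hvu t ht y hy

theorem continuous_eval_smoothFunctions (p : M) :
    Continuous fun f : C^∞⟮I, M; 𝓘(ℝ, ℝ), ℝ⟯ => f p := by
  have h0 : Continuous (chartDeriv p 0 : C^∞⟮I, M; 𝓘(ℝ, ℝ), ℝ⟯ → _) :=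
    continuous_iff_le_induced.2 ((iInf_le _ p).trans (iInf_le _ 0))
  have h1 := (UniformOnFun.uniformContinuous_eval_of_mem (E [×0]→L[ℝ] ℝ)
    {K : Set E | IsCompact K ∧ K ⊆ (extChartAt I p).target} (mem_singleton (extChartAt I p p))
    ⟨isCompact_singleton, singleton_subset_iff.2 (mem_extChartAt_target p)⟩).continuous.comp h0
  have h2 := (ContinuousMultilinearMap.apply ℝ (fun _ : Fin 0 => E) ℝ 0).continuous.comp h1
  refine h2.congr fun f => ?_
  change iteratedFDerivWithin ℝ 0 (f ∘ (extChartAt I p).symm) (extChartAt I p).target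
    (extChartAt I p p) 0 = f p
  simp

/-- Integrating out a real variable preserves smoothness on a manifold. -/
theorem contMDiff_integral_unitInterval [IsManifold I ∞ M] {G : ℝ × M → ℝ}
    (hG : ContMDiff (𝓘(ℝ, ℝ).prod I) 𝓘(ℝ, ℝ) ∞ G) :
    ContMDiff I 𝓘(ℝ, ℝ) ∞ fun p => ∫ u in (0 : ℝ)..1, G (u, p) := by
  intro x
  rw [contMDiffAt_iff_source, contMDiffWithinAt_iff_contDiffWithinAt]
  obtain ⟨δ, hδ, hball⟩ :=
    Metric.mem_nhdsWithin_iff.1 (extChartAt_target_mem_nhdsWithin (I := I) x)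
  let S : Set E := range I ∩ Metric.ball (extChartAt I x x) δ
  have hST : S ⊆ (extChartAt I x).target := fun y hy => hball ⟨hy.2, hy.1⟩
  have hconv : Convex ℝ S := I.convex_range.inter (convex_ball _ _)
  have huniq : UniqueDiffOn ℝ S := I.uniqueDiffOn.inter Metric.isOpen_ball
  have hg : ContDiffOn ℝ ∞ (fun q : ℝ × E => G (q.1, (extChartAt I x).symm q.2)) (univ ×ˢ S) := by
    rw [← contMDiffOn_iff_contDiffOn, modelWithCornersSelf_prod, ← chartedSpaceSelf_prod]
    have h1 : ContMDiffOn (𝓘(ℝ, ℝ).prod 𝓘(ℝ, E)) (𝓘(ℝ, ℝ).prod I) ∞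
        (fun q : ℝ × E => (q.1, (extChartAt I x).symm q.2)) (univ ×ˢ S) :=
      contMDiffOn_fst.prodMk
        ((contMDiffOn_extChartAt_symm x).comp contMDiffOn_snd fun q hq => hST hq.2)
    have h2 := hG.comp_contMDiffOn h1
    exact h2
  have h := contDiffOn_integral_unitInterval hconv huniq hg
  have hx : extChartAt I x x ∈ S := ⟨mem_range_self _, Metric.mem_ball_self hδ⟩
  exact (h _ hx).mono_of_mem_nhdsWithin
    (inter_mem_nhdsWithin _ (Metric.ball_mem_nhds _ hδ))

end Curves

/-! ### The exponential function -/

namespace SmoothFlow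

variable {E : Type*} [NormedAddCommGroup E] [NormedSpace ℝ E]
  {H : Type*} [TopologicalSpace H] {I : ModelWithCorners ℝ E H}
  {M : Type*} [TopologicalSpace M] [ChartedSpace H M] (σ : SmoothFlow I M)

theorem groupChart_injective : Function.Injective σ.groupChart := fun _ _ h =>
  SemidirectProduct.ext (congrArg Prod.fst h) (congrArg Prod.snd h)

theorem groupChart_mul (a b : σ.SemidirectGroup) :
    σ.groupChart (a * b) = ((σ.groupChart a).1 + σ.pullback (σ.groupChart a).2 (σ.groupChart b).1,
      (σ.groupChart a).2 + (σ.groupChart b).2) := rfl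

variable [IsManifold I ∞ M]

theorem average_apply (s : ℝ) (f : C^∞⟮I, M; 𝓘(ℝ, ℝ), ℝ⟯) (p : M) :
    σ.average s f p = ∫ u in (0 : ℝ)..1, f (σ.toFlow (u * s) p) := rfl

theorem continuous_average_mul (s : ℝ) (f : C^∞⟮I, M; 𝓘(ℝ, ℝ), ℝ⟯) :
    Continuous fun t : ℝ => σ.average (t * s) f := by
  refine continuous_curve_of_contMDiff _ ?_
  refine contMDiff_integral_unitInterval
    (G := fun q : ℝ × (ℝ × M) => f (σ.toFlow (q.1 * (q.2.1 * s)) q.2.2)) ?_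
  refine f.contMDiff.comp (σ.contMDiff_toFun.comp (ContMDiff.prodMk ?_ ?_))
  · exact contMDiff_fst.mul ((contMDiff_fst.comp contMDiff_snd).mul contMDiff_const)
  · exact contMDiff_snd.comp contMDiff_snd

theorem continuous_smul_const (f : C^∞⟮I, M; 𝓘(ℝ, ℝ), ℝ⟯) : Continuous fun t : ℝ => t • f := by
  refine continuous_curve_of_contMDiff _ ?_
  exact contMDiff_fst.mul (f.contMDiff.comp contMDiff_snd)

theorem mul_average_apply (s t : ℝ) (f : C^∞⟮I, M; 𝓘(ℝ, ℝ), ℝ⟯) (p : M) :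
    t * σ.average (t * s) f p = ∫ v in (0 : ℝ)..t, f (σ.toFlow (v * s) p) := by
  rw [average_apply]
  have := intervalIntegral.mul_integral_comp_mul_right (a := 0) (b := 1)
    (f := fun v => f (σ.toFlow (v * s) p)) t
  simpa [mul_assoc] using this

/-- The exponential function `(f, s) ↦ (β_s f, s)`. -/
noncomputable def expMap (x : C^∞⟮I, M; 𝓘(ℝ, ℝ), ℝ⟯ × ℝ) : σ.SemidirectGroup :=
  ⟨Multiplicative.ofAdd (σ.average x.2 x.1), Multiplicative.ofAdd x.2⟩

theorem groupChart_expMap (x : C^∞⟮I, M; 𝓘(ℝ, ℝ), ℝ⟯ × ℝ) :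
    σ.groupChart (σ.expMap x) = (σ.average x.2 x.1, x.2) := rfl

theorem isExponentialFunction_expMap : σ.IsExponentialFunction σ.expMap := by
  rintro ⟨f, r⟩
  refine ⟨fun s t => σ.groupChart_injective ?_, ?_⟩
  · rw [groupChart_mul]
    simp only [groupChart_expMap, Prod.smul_mk, smul_eq_mul]
    refine Prod.ext ?_ (add_mul s t r)
    ext p
    have hint : ∀ a b, IntervalIntegrable (fun v => f (σ.toFlow (v * r) p)) volume a b :=
      fun a b => (σ.continuous_integrand r f p).intervalIntegrable a b
    have h1 : (t * σ.average (t * r) f (σ.toFlow (s * r) p)) =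
        ∫ v in s..(s + t), f (σ.toFlow (v * r) p) := by
      rw [mul_average_apply]
      have := intervalIntegral.integral_comp_add_right (a := 0) (b := t)
        (fun v => f (σ.toFlow (v * r) p)) s
      rw [zero_add, add_comm t s] at this
      rw [← this]
      refine intervalIntegral.integral_congr fun v _ => ?_
      rw [← Flow.map_add, add_mul]
    have h2 : σ.average ((s + t) * r) ((s + t) • f) p =
        (s + t) * σ.average ((s + t) * r) f p := by rw [map_smul]; rfl
    have h3 : σ.average (s * r) (s • f) p = s * σ.average (s * r) f p := by rw [map_smul]; rfl
    have h4 : σ.average (t * r) (t • f) (σ.toFlow (s * r) p) =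
        t * σ.average (t * r) f (σ.toFlow (s * r) p) := by rw [map_smul]; rfl
    change σ.average ((s + t) * r) ((s + t) • f) p = σ.average (s * r) (s • f) p +
      σ.average (t * r) (t • f) (σ.toFlow (s * r) p)
    rw [h2, h3, h4, h1, mul_average_apply, mul_average_apply,
      intervalIntegral.integral_add_adjacent_intervals (hint _ _) (hint _ _)]
  · have h0 : σ.average 0 f = f := by ext p; simp [average_apply]
    have hc : Tendsto (fun t : ℝ => (σ.average (t * r) f, r)) (𝓝[≠] 0) (𝓝 (f, r)) := by
      have h := (σ.continuous_average_mul r f).tendsto 0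
      rw [zero_mul, h0] at h
      exact (h.mono_left nhdsWithin_le_nhds).prodMk_nhds tendsto_const_nhds
    refine hc.congr' ?_
    filter_upwards [self_mem_nhdsWithin] with t (ht : t ≠ 0)
    simp only [groupChart_expMap, zero_add, Prod.smul_mk, smul_eq_mul, map_smul]
    refine Prod.ext ?_ ?_
    · simp [smul_smul, ht]
    · simp [ht]

/-- A one-parameter group of `C^∞(M) ⋊ ℝ` is determined by its derivative at `0`: its second
component is linear and, at each point, its first component solves an elementary differential
equation along the flow. -/
theorem eq_expMap {e : C^∞⟮I, M; 𝓘(ℝ, ℝ), ℝ⟯ × ℝ → σ.SemidirectGroup}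
    (he : σ.IsExponentialFunction e) : e = σ.expMap := by
  funext x
  obtain ⟨hmul, hder⟩ := he x
  let A : ℝ → C^∞⟮I, M; 𝓘(ℝ, ℝ), ℝ⟯ := fun t => (σ.groupChart (e (t • x))).1
  let b : ℝ → ℝ := fun t => (σ.groupChart (e (t • x))).2
  have hA : ∀ s t, A (s + t) = A s + σ.pullback (b s) (A t) := fun s t => by
    simp only [A, hmul s t, groupChart_mul]; rfl
  have hb : ∀ s t, b (s + t) = b s + b t := fun s t => by
    simp only [b, hmul s t, groupChart_mul]
  have hb0 : b 0 = 0 := by simpa using hb 0 0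
  have hA0 : A 0 = 0 := by
    have h := hA 0 0
    rw [add_zero] at h
    have h' := left_eq_add.1 h
    exact (AddEquiv.map_eq_zero_iff _).1 h'
  have hd : Tendsto (fun t : ℝ => (t⁻¹ • A t, t⁻¹ * b t)) (𝓝[≠] 0) (𝓝 x) := by
    refine hder.congr fun t => ?_
    have : σ.groupChart (e 0) = 0 := by
      refine Prod.ext ?_ ?_
      · simpa [A] using hA0
      · simpa [b] using hb0
    simp only [this, zero_add, sub_zero]
    rfl
  have hdb : ∀ t, HasDerivAt b x.2 t := fun t => by
    rw [hasDerivAt_iff_tendsto_slope_zero]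
    refine ((continuous_snd.tendsto x).comp hd).congr fun h => ?_
    simp [hb]
  have hbt : ∀ t, b t = t * x.2 := by
    have hconst : ∀ t, b t - t * x.2 = b 0 - 0 * x.2 := fun t =>
      is_const_of_deriv_eq_zero (f := fun t => b t - t * x.2)
        (fun t => ((hdb t).sub ((hasDerivAt_id t).mul_const x.2)).differentiableAt)
        (fun t => ((hdb t).sub ((hasDerivAt_id t).mul_const x.2)).deriv.trans (by simp)) t 0
    intro t
    have := hconst t
    rw [hb0] at this
    linarith
  have hdA : ∀ (p : M) (t : ℝ), HasDerivAt (fun t => A t p) (x.1 (σ.toFlow (t * x.2) p)) t := by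
    intro p t
    rw [hasDerivAt_iff_tendsto_slope_zero]
    refine (((continuous_eval_smoothFunctions (σ.toFlow (t * x.2) p)).comp
      continuous_fst).tendsto x |>.comp hd).congr fun h => ?_
    have : A (t + h) p = A t p + A h (σ.toFlow (t * x.2) p) := by
      rw [hA, hbt]; rfl
    rw [this, add_sub_cancel_left]
    rfl
  apply σ.groupChart_injective
  rw [groupChart_expMap]
  have h1 : e x = e ((1 : ℝ) • x) := by rw [one_smul]
  rw [h1]
  refine Prod.ext ?_ (by simpa [b] using hbt 1)
  ext p
  have := intervalIntegral.integral_eq_sub_of_hasDerivAt (a := 0) (b := 1)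
    (fun t _ => hdA p t) ((σ.continuous_integrand x.2 x.1 p).intervalIntegrable 0 1)
  rw [average_apply, this, hA0]
  exact (sub_zero (A 1 p)).symm

theorem existsUnique_exponentialFunction : ∃! e, σ.IsExponentialFunction e :=
  ⟨σ.expMap, σ.isExponentialFunction_expMap, fun _ he => σ.eq_expMap he⟩

/-- As `(f, s) ↦ (β_s f, s)` preserves the second component, its image can contain a neighbourhood
of `0` only if `β_s` is surjective for all small `s`. -/
theorem eventually_surjective_of_isLocalDiffeoAt
    (h : IsLocalDiffeoAt (fun x => σ.groupChart (σ.expMap x)) 0) :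
    ∀ᶠ s in 𝓝 (0 : ℝ), Function.Surjective (σ.average s) := by
  obtain ⟨U, U', g, h0, hU, -, -, hg, -, hU', -⟩ := h
  have h0' : (0 : C^∞⟮I, M; 𝓘(ℝ, ℝ), ℝ⟯ × ℝ) ∈ U' := by
    have h1 := hU h0
    have h2 : σ.groupChart (σ.expMap 0) = 0 := by
      rw [groupChart_expMap]
      exact Prod.ext (map_zero (σ.average 0)) rfl
    simpa [h2] using h1
  have hs : ∀ᶠ s in 𝓝 (0 : ℝ), ((0 : C^∞⟮I, M; 𝓘(ℝ, ℝ), ℝ⟯), s) ∈ U' :=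
    (Continuous.prodMk_right (0 : C^∞⟮I, M; 𝓘(ℝ, ℝ), ℝ⟯)).continuousAt.eventually_mem
      (hU'.mem_nhds h0')
  filter_upwards [hs] with s hs w
  have hw : ∀ᶠ t in 𝓝 (0 : ℝ), (t • w, s) ∈ U' := by
    have hc : Continuous fun t : ℝ => (t • w, s) := (continuous_smul_const w).prodMk continuous_const
    exact hc.continuousAt.eventually_mem (hU'.mem_nhds (by simpa using hs))
  obtain ⟨t, htU, ht⟩ := ((hw.filter_mono nhdsWithin_le_nhds).and
    (self_mem_nhdsWithin : {(0 : ℝ)}ᶜ ∈ 𝓝[≠] 0)).exists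
  have h3 : σ.groupChart (σ.expMap (g (t • w, s))) = (t • w, s) := hg htU
  rw [groupChart_expMap] at h3
  obtain ⟨h4, h5⟩ := Prod.ext_iff.1 h3
  simp only at h4 h5
  rw [h5] at h4
  refine ⟨t⁻¹ • (g (t • w, s)).1, ?_⟩
  rw [map_smul, h4, smul_smul, inv_mul_cancel₀ ht, one_smul]

end SmoothFlow

/-! ### Countability of asymptotic frequencies -/

theorem exists_ge_cexp_eq_neg {l m : ℝ} (hlm : l ≠ m) (T : ℝ) :
    ∃ t ≥ T, Complex.exp (Complex.I * (l * t)) = -Complex.exp (Complex.I * (m * t)) := by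
  obtain ⟨n, hn⟩ := exists_nat_ge (|l - m| * T / Real.pi)
  have hd : 0 < |l - m| := abs_pos.2 (sub_ne_zero.2 hlm)
  refine ⟨(2 * n + 1) * Real.pi / |l - m|, ?_, ?_⟩
  · rw [ge_iff_le, le_div_iff₀ hd]
    rw [div_le_iff₀ Real.pi_pos] at hn
    nlinarith [Real.pi_pos, Nat.cast_nonneg (α := ℝ) n]
  · set t := (2 * n + 1) * Real.pi / |l - m| with ht
    have hcos : Real.cos ((l - m) * t) = -1 := by
      have h1 : |(l - m) * t| = Real.pi + n * (2 * Real.pi) := by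
        rw [abs_mul, abs_of_nonneg (by positivity : 0 ≤ t), ht]
        field_simp
        ring
      rw [← Real.cos_abs, h1, Real.cos_add_nat_mul_two_pi, Real.cos_pi]
    have hsin : Real.sin ((l - m) * t) = 0 := by
      have := Real.sin_sq_add_cos_sq ((l - m) * t)
      rw [hcos] at this
      nlinarith
    have h2 : Complex.exp (((l - m) * t : ℝ) * Complex.I) = -1 := by
      rw [Complex.exp_mul_I, ← Complex.ofReal_cos, ← Complex.ofReal_sin, hcos, hsin]
      simp
    have h3 : Complex.I * (l * t) = Complex.I * (m * t) + ((l - m) * t : ℝ) * Complex.I := by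
      push_cast
      ring
    rw [h3, Complex.exp_add, h2, mul_neg_one]

/-- Only countably many frequencies `l` are such that some continuous function on a compact
metrizable space equals `exp (i l t)` along the end of a given curve: functions for distinct
frequencies are uniformly separated, and `C(X, ℂ)` is separable. -/
theorem countable_setOf_asymptotic_frequency {X : Type*} [TopologicalSpace X] [CompactSpace X]
    [T2Space X] [SecondCountableTopology X] (c : ℝ → X) :
    {l : ℝ | ∃ G : C(X, ℂ), ∀ᶠ t in atTop, G (c t) = Complex.exp (Complex.I * (l * t))}.Countable
    := by
  set S := {l : ℝ | ∃ G : C(X, ℂ), ∀ᶠ t in atTop, G (c t) = Complex.exp (Complex.I * (l * t))}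
  choose! G hG using fun (l : ℝ) (hl : l ∈ S) => hl
  refine Set.PairwiseDisjoint.countable_of_isOpen (s := fun l => Metric.ball (G l) 1) ?_
    (fun _ _ => Metric.isOpen_ball) fun l _ => ⟨G l, Metric.mem_ball_self one_pos⟩
  intro l hl m hm hlm
  refine Metric.ball_disjoint_ball ?_
  obtain ⟨T, hT⟩ := eventually_atTop.1 ((hG l hl).and (hG m hm))
  obtain ⟨t, htT, ht⟩ := exists_ge_cexp_eq_neg hlm T
  refine le_trans ?_ (ContinuousMap.dist_apply_le_dist (f := G l) (g := G m) (c t))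
  rw [(hT t htT).1, (hT t htT).2, ht, dist_eq_norm, ← neg_add', norm_neg, ← two_mul (Complex.exp _),
    norm_mul, mul_comm Complex.I, ← Complex.ofReal_mul, Complex.norm_exp_ofReal_mul_I]
  norm_num

/-! ### Averages with compact support on a line -/

/-- If the running average `∫₀¹ h (t + u s) du` is a nontrivial nonnegative bump, supported in a short
interval around `0`, then the running Fourier coefficient
`∫₀¹ h (t + u s) exp (-2πi (t + u s) / s) du` of `h` is constant on both sides of the support, with
two different values. -/
theorem fourier_average_of_bump {h : ℝ → ℝ} (hc : Continuous h) {s ε : ℝ} (hs : s ≠ 0)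
    (hε : 0 < ε) (hεs : 4 * ε ≤ |s|) {F : ℝ → ℝ} (hF : ∀ t, F t = ∫ u in (0 : ℝ)..1, h (u * s + t))
    (hF0 : 0 < F 0) (hFn : ∀ t, 0 ≤ F t) (hFs : ∀ t, ε ≤ |t| → F t = 0)
    {Φ : ℝ → ℂ} (hΦ : ∀ t, Φ t = ∫ u in (0 : ℝ)..1, (h (u * s + t) : ℂ) *
      Complex.exp (Complex.I * ((-2 * Real.pi / s : ℝ) * (u * s + t : ℝ)))) :
    (∀ t ≥ ε, Φ t = Φ ε) ∧ (∀ t ≤ -ε, Φ t = Φ (-ε)) ∧ Φ ε ≠ Φ (-ε) := by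
  set w : ℝ := -2 * Real.pi / s with hw
  have hws : w * s = -2 * Real.pi := by rw [hw]; field_simp
  let e : ℝ → ℂ := fun t => Complex.exp (Complex.I * (w * (t : ℝ)))
  have hec : Continuous e := by fun_prop
  have hes : ∀ t, e (s + t) = e t := fun t => by
    have : Complex.I * (w * ((s + t : ℝ) : ℂ)) = Complex.I * (w * t) - 2 * Real.pi * Complex.I := by
      have : (w : ℂ) * s = -2 * Real.pi := by exact_mod_cast congrArg ((↑) : ℝ → ℂ) hws
      push_cast
      linear_combination Complex.I * this
    simp only [e, this]
    exact Complex.exp_periodic.sub_eq _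
  have hde : ∀ t, HasDerivAt e (Complex.I * w * e t) t := fun t => by
    have h1 : HasDerivAt (fun t : ℝ => Complex.I * ((w : ℂ) * (t : ℂ))) (Complex.I * (w * 1)) t :=
      ((Complex.ofRealCLM.hasDerivAt (x := t)).const_mul (w : ℂ)).const_mul Complex.I
    exact h1.cexp.congr_deriv (by simp only [e]; ring)
  -- both averages are difference quotients of primitives
  have hprim : ∀ {k : ℝ → ℂ}, Continuous k → ∀ t, HasDerivAt
      (fun t => ∫ u in (0 : ℝ)..1, k (u * s + t)) ((s : ℂ)⁻¹ * (k (s + t) - k t)) t := by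
    intro k hk t
    have h1 : ∀ a, HasDerivAt (fun x => ∫ v in (0 : ℝ)..x, k v) (k a) a := fun a =>
      intervalIntegral.integral_hasDerivAt_right (hk.intervalIntegrable _ _)
        hk.stronglyMeasurable.stronglyMeasurableAtFilter hk.continuousAt
    have h2 := (((h1 (s + t)).comp_const_add s t).sub (h1 t)).const_mul (s : ℂ)⁻¹
    refine h2.congr_of_eventuallyEq (Eventually.of_forall fun x => ?_)
    have h3 := intervalIntegral.integral_comp_mul_add (a := 0) (b := 1) k hs x
    simp only [Pi.sub_apply, mul_comm _ s]
    rw [h3, mul_zero, zero_add, mul_one, ← intervalIntegral.integral_interval_sub_left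
      (hk.intervalIntegrable _ _) (hk.intervalIntegrable _ _), Complex.real_smul]
    push_cast
    rfl
  have hhc : Continuous fun v => (h v : ℂ) := by fun_prop
  have hFd : ∀ t, HasDerivAt (fun t => (F t : ℂ)) ((s : ℂ)⁻¹ * (h (s + t) - h t)) t := fun t => by
    refine (hprim hhc t).congr_of_eventuallyEq (Eventually.of_forall fun x => ?_)
    change ((F x : ℝ) : ℂ) = _
    rw [hF x]
    exact intervalIntegral.integral_ofReal.symm
  have hΦd : ∀ t, HasDerivAt Φ ((s : ℂ)⁻¹ * (h (s + t) - h t) * e t) t := fun t => by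
    have := (hprim (hhc.mul hec) t).congr_of_eventuallyEq (Eventually.of_forall hΦ)
    refine this.congr_deriv ?_
    change (s : ℂ)⁻¹ * (h (s + t) * e (s + t) - h t * e t) = _
    rw [hes]
    ring
  -- integration by parts
  have hΨd : ∀ t, HasDerivAt (fun t => Φ t - F t * e t) (-(Complex.I * w) * (F t * e t)) t :=
    fun t => ((hΦd t).sub ((hFd t).mul (hde t))).congr_deriv (by ring)
  have hFc : Continuous F := by
    have : Continuous fun t => (F t : ℂ) := continuous_iff_continuousAt.2 fun t =>
      (hFd t).continuousAt
    exact Complex.continuous_re.comp this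
  have hFec : Continuous fun t => (F t : ℂ) * e t := by fun_prop
  have hint : ∀ a b, (Φ b - F b * e b) - (Φ a - F a * e a) =
      -(Complex.I * w) * ∫ t in a..b, F t * e t := fun a b => by
    rw [← intervalIntegral.integral_const_mul]
    exact (intervalIntegral.integral_eq_sub_of_hasDerivAt (fun t _ => hΨd t)
      ((continuous_const.mul hFec).intervalIntegrable a b)).symm
  have hzero : ∀ a b, (∀ t ∈ uIcc a b, ε ≤ |t|) → Φ b = Φ a := fun a b hab => by
    have h1 := hint a b
    have h2 : ∫ t in a..b, (F t : ℂ) * e t = 0 := by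
      rw [intervalIntegral.integral_congr (g := fun _ => 0)]
      · simp
      · intro t ht
        simp [hFs t (hab t ht)]
    rw [h2, hFs a (hab a left_mem_uIcc), hFs b (hab b right_mem_uIcc)] at h1
    simpa [sub_eq_zero] using h1
  refine ⟨fun t ht => hzero _ _ fun v hv => ?_, fun t ht => hzero _ _ fun v hv => ?_, fun heq => ?_⟩
  · rw [uIcc_of_le ht] at hv
    exact hv.1.trans (le_abs_self v)
  · rw [uIcc_of_ge ht] at hv
    exact (le_neg.1 hv.2).trans (neg_le_abs v)
  · have h1 := hint (-ε) ε
    rw [hFs ε (le_abs_self ε), hFs (-ε) (by rw [abs_neg]; exact le_abs_self ε), heq] at h1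
    have hw0 : w ≠ 0 := by
      intro h0
      rw [h0, zero_mul] at hws
      linarith [Real.pi_pos]
    have h2 : ∫ t in (-ε)..ε, (F t : ℂ) * e t = 0 := by
      simpa [hw0] using h1
    have h3 : ∫ t in (-ε)..ε, F t * Real.cos (w * t) = 0 := by
      have h4 := Complex.reCLM.intervalIntegral_comp_comm
        (hFec.intervalIntegrable (μ := volume) (-ε) ε)
      rw [h2, map_zero] at h4
      rw [← h4]
      refine intervalIntegral.integral_congr fun t _ => ?_
      simp only [Complex.reCLM_apply, Complex.re_ofReal_mul, e]
      rw [mul_comm Complex.I, ← Complex.ofReal_mul, Complex.exp_ofReal_mul_I_re]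
    -- on the support the phase stays within a quarter turn, so the cosine is nonnegative
    refine (intervalIntegral.integral_pos (by linarith : -ε < ε)
      (f := fun t => F t * Real.cos (w * t)) (by fun_prop) (fun t ht => ?_)
      ⟨0, ⟨by linarith, hε.le⟩, by simpa using hF0⟩).ne' h3
    refine mul_nonneg (hFn t) ?_
    rw [← Real.cos_abs]
    have ht' : |t| ≤ ε := abs_le.2 ⟨ht.1.le, ht.2⟩
    have h5 : |w * t| ≤ Real.pi / 2 := by
      have h6 : |w| * |s| = 2 * Real.pi := by
        rw [← abs_mul, hws, neg_mul, abs_neg, abs_of_pos (by positivity)]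
      rw [abs_mul]
      have h7 : |w| * |t| ≤ |w| * ε := by gcongr
      have h8 : |w| * (4 * ε) ≤ |w| * |s| := by gcongr
      linarith
    exact Real.cos_nonneg_of_neg_pi_div_two_le_of_le
      (by linarith [abs_nonneg (w * t), Real.pi_pos]) h5

/-! ### Locally closed nonperiodic orbits -/

/-- A locally closed orbit without period is embedded: by Baire's theorem, some compact piece of it
has interior relative to the orbit. Hence points outside a neighbourhood of `0` in time stay in a
closed set away from the base point. -/
theorem Flow.exists_isClosed_of_isLocallyClosed_orbit {X : Type*} [TopologicalSpace X]
    [CompactSpace X] [T2Space X] (φ : Flow ℝ X) {p : X} (hp : ∀ t : ℝ, t ≠ 0 → φ t p ≠ p)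
    (ho : IsLocallyClosed (φ.orbit p)) {ε : ℝ} (hε : 0 < ε) :
    ∃ C : Set X, IsClosed C ∧ p ∉ C ∧ ∀ t, ε ≤ |t| → φ t p ∈ C := by
  have hinj : ∀ s t, φ s p = φ t p → s = t := fun s t hst => by
    by_contra hne
    refine hp (-t + s) (fun h => hne (by linarith)) ?_
    rw [Flow.map_add, hst, ← Flow.map_add, neg_add_cancel, Flow.map_zero_apply]
  have hcont : Continuous fun t => φ t p := by fun_prop
  have hcl : ∀ {K : Set ℝ}, IsCompact K → IsClosed ((fun t => φ t p) '' K) := fun hK =>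
    (hK.image hcont).isClosed
  have := ho.locallyCompactSpace
  have : Nonempty (φ.orbit p) := ⟨⟨p, φ.mem_orbit_self p⟩⟩
  obtain ⟨n, ⟨q, hqo⟩, hq⟩ := nonempty_interior_of_iUnion_of_closed
    (f := fun n : ℕ => ((↑) : φ.orbit p → X) ⁻¹' ((fun t => φ t p) '' Icc (-n : ℝ) n))
    (fun n => (hcl isCompact_Icc).preimage continuous_subtype_val) (by
      refine eq_univ_of_forall fun ⟨q, hq⟩ => ?_
      obtain ⟨t, rfl⟩ := hq
      obtain ⟨n, hn⟩ := exists_nat_ge |t|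
      exact mem_iUnion.2 ⟨n, t, abs_le.1 hn, rfl⟩)
  obtain ⟨t₀, rfl⟩ := hqo
  obtain ⟨V, hV, hVn⟩ := mem_nhds_subtype _ _ _ |>.1 (mem_interior_iff_mem_nhds.1 hq)
  obtain ⟨V', hV'V, hV', hpV'⟩ := mem_nhds_iff.1 hV
  set a : ℝ := n + |t₀|
  have ha : ∀ t, φ t₀ (φ t p) ∈ V' → |t| ≤ a := fun t ht => by
    rw [← Flow.map_add] at ht
    obtain ⟨t', ht', htt'⟩ := hVn (show (⟨φ (t₀ + t) p, t₀ + t, rfl⟩ : φ.orbit p) ∈ _ from hV'V ht)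
    have h1 := hinj _ _ htt'
    have h2 : t = t' - t₀ := by linarith
    rw [h2]
    exact (abs_sub t' t₀).trans (add_le_add_left (abs_le.2 ht') _)
  refine ⟨(φ t₀ ⁻¹' V')ᶜ ∪ (fun t => φ t p) '' (Icc (-a) a \ Ioo (-ε) ε),
    (hV'.preimage (by fun_prop)).isClosed_compl.union (hcl (isCompact_Icc.diff isOpen_Ioo)), ?_,
    fun t ht => ?_⟩
  · rintro (h | ⟨t, ht, htp⟩)
    · exact h hpV'
    · have : t = 0 := hinj t 0 (htp.trans (φ.map_zero_apply p).symm)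
      exact ht.2 (this ▸ ⟨by linarith, hε⟩)
  · by_cases h : φ t₀ (φ t p) ∈ V'
    · exact Or.inr ⟨t, ⟨abs_le.1 (ha t h), fun h' => ht.not_gt (abs_lt.2 h')⟩, rfl⟩
    · exact Or.inl h

namespace SmoothFlow

variable {E : Type*} [NormedAddCommGroup E] [NormedSpace ℝ E]
  {H : Type*} [TopologicalSpace H] {I : ModelWithCorners ℝ E H}
  {M : Type*} [TopologicalSpace M] [ChartedSpace H M] (σ : SmoothFlow I M)

theorem continuous_fourierAverage (s : ℝ) (g : C^∞⟮I, M; 𝓘(ℝ, ℝ), ℝ⟯) (k : ℝ → ℂ)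
    (hk : Continuous k) :
    Continuous fun q => ∫ u in (0 : ℝ)..1, (g (σ.toFlow (u * s) q) : ℂ) * k u := by
  refine intervalIntegral.continuous_parametric_intervalIntegral_of_continuous' ?_ 0 1
  have : Continuous fun x : M × ℝ => g (σ.toFlow (x.2 * s) x.1) :=
    g.contMDiff.continuous.comp (by fun_prop)
  exact (Complex.continuous_ofReal.comp this).mul (hk.comp continuous_snd)

variable [FiniteDimensional ℝ E] [IsManifold I ∞ M] [CompactSpace M] [T2Space M]

/-- If `β_s` hits a bump function around a locally closed nonperiodic orbit, then `2π/s` is a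
frequency of a continuous function along one of the two ends of the orbit. -/
theorem exists_asymptotic_frequency {p : M} (hp : ∀ t : ℝ, t ≠ 0 → σ.toFlow t p ≠ p)
    (ho : IsLocallyClosed (σ.toFlow.orbit p)) {s : ℝ} (hs : s ≠ 0)
    (hsurj : Function.Surjective (σ.average s)) :
    (∃ G : C(M, ℂ), ∀ᶠ t in atTop, G (σ.toFlow t p) =
      Complex.exp (Complex.I * ((2 * Real.pi / s : ℝ) * t))) ∨
    (∃ G : C(M, ℂ), ∀ᶠ t in atTop, G (σ.toFlow (-t) p) =
      Complex.exp (Complex.I * ((2 * Real.pi / (-s) : ℝ) * t))) := by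
  have hε : 0 < |s| / 4 := by positivity
  set ε := |s| / 4 with hεdef
  obtain ⟨C, hC, hpC, hCt⟩ := σ.toFlow.exists_isClosed_of_isLocallyClosed_orbit hp ho hε
  obtain ⟨f, hfC, hfp, hf01⟩ := exists_contMDiffMap_zero_one_of_isClosed I (n := (⊤ : ℕ∞)) hC
    (isClosed_singleton (x := p)) (disjoint_singleton_right.2 hpC)
  obtain ⟨g, hg⟩ := hsurj f
  let w : ℝ := -2 * Real.pi / s
  let k : ℝ → ℂ := fun u => Complex.exp (Complex.I * ((w : ℝ) * (u * s : ℝ)))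
  have hk : Continuous k := by fun_prop
  let G : C(M, ℂ) := ⟨_, σ.continuous_fourierAverage s g k hk⟩
  let Φ : ℝ → ℂ := fun t => G (σ.toFlow t p) * Complex.exp (Complex.I * (w * (t : ℝ)))
  obtain ⟨h1, h2, h3⟩ := fourier_average_of_bump (h := fun t => g (σ.toFlow t p))
    (g.contMDiff.continuous.comp (by fun_prop)) hs hε (by rw [hεdef]; linarith)
    (F := fun t => f (σ.toFlow t p)) (fun t => by
      simp only [← hg, average_apply, Flow.map_add])
    (by simp [hfp rfl]) (fun t => (hf01 _).1)
    (fun t ht => hfC (hCt t ht)) (Φ := Φ) (fun t => by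
      change (∫ u in (0 : ℝ)..1, (g (σ.toFlow (u * s) (σ.toFlow t p)) : ℂ) * k u) * _ = _
      rw [← intervalIntegral.integral_mul_const]
      refine intervalIntegral.integral_congr fun u _ => ?_
      simp only [k, mul_assoc, ← Complex.exp_add, ← Flow.map_add]
      congr 2
      simp only [w]
      push_cast
      ring)
  have hexp : ∀ {c : ℂ}, c ≠ 0 → ∀ t, Φ t = c →
      (c⁻¹ • G) (σ.toFlow t p) = Complex.exp (Complex.I * ((2 * Real.pi / s : ℝ) * t)) := by
    intro c hc t ht
    have h4 : Complex.exp (Complex.I * (w * t)) *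
        Complex.exp (Complex.I * ((2 * Real.pi / s : ℝ) * t)) = 1 := by
      rw [← Complex.exp_add, ← Complex.exp_zero]
      congr 1
      simp only [w]
      push_cast
      ring
    rw [ContinuousMap.smul_apply, smul_eq_mul, inv_mul_eq_iff_eq_mul₀ hc, ← ht]
    simp only [Φ]
    rw [mul_assoc, h4, mul_one]
  by_cases h0 : Φ ε = 0
  · rw [h0] at h3
    refine Or.inr ⟨(Φ (-ε))⁻¹ • G, ?_⟩
    filter_upwards [eventually_ge_atTop ε] with t ht
    rw [hexp h3.symm (-t) (h2 (-t) (neg_le_neg ht))]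
    congr 1
    push_cast
    ring
  · refine Or.inl ⟨(Φ ε)⁻¹ • G, ?_⟩
    filter_upwards [eventually_ge_atTop ε] with t ht
    exact hexp h0 t (h1 t ht)

theorem ae_not_surjective_average (h : σ.HasNonperiodicLocallyClosedOrbit) :
    ∀ᵐ s : ℝ ∂volume, ¬ Function.Surjective (σ.average s) := by
  obtain ⟨p, hp, ho⟩ := h
  have := I.secondCountableTopology
  have := ChartedSpace.secondCountable_of_sigmaCompact H M
  have hinj : Function.Injective fun s : ℝ => 2 * Real.pi / s := fun s t hst => by
    have h2 : (2 * Real.pi) ≠ 0 := by positivity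
    simpa [div_eq_mul_inv, h2] using hst
  have hc₁ := (countable_setOf_asymptotic_frequency fun t => σ.toFlow t p).preimage hinj
  have hc₂ := (countable_setOf_asymptotic_frequency fun t => σ.toFlow (-t) p).preimage
    (hinj.comp neg_injective)
  refine measure_mono_null (fun s hs => ?_)
    (((countable_singleton (0 : ℝ)).union (hc₁.union hc₂)).measure_zero volume)
  by_cases h0 : s = 0
  · exact Or.inl h0
  · exact Or.inr (σ.exists_asymptotic_frequency hp ho h0 (not_not.1 hs))

end SmoothFlow

/-! ### Linear flows on tori -/

namespace SmoothFlow

variable {E : Type*} [NormedAddCommGroup E] [NormedSpace ℝ E] [FiniteDimensional ℝ E]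
  {H : Type*} [TopologicalSpace H] {I : ModelWithCorners ℝ E H}
  {M : Type*} [TopologicalSpace M] [ChartedSpace H M] [IsManifold I ∞ M]
  [CompactSpace M] [T2Space M] (σ : SmoothFlow I M)

/-- If the flow is linear on an embedded torus and the character `z ↦ z_j ^ m` has full periods over
time `s`, then the corresponding Fourier coefficient vanishes on the image of `β_s`. -/
theorem not_surjective_average_of_torus {d : ℕ} {θ : Fin d → ℝ} {ι : (Fin d → Circle) → M}
    (hι : Continuous ι) (hinj : Function.Injective ι)
    (hflow : ∀ (t : ℝ) (z : Fin d → Circle),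
      σ.toFlow t (ι z) = ι (fun j => Circle.exp (t * θ j) * z j))
    {j : Fin d} {m n : ℤ} (hn : n ≠ 0) {s : ℝ} (hs : m * (s * θ j) = n * (2 * Real.pi)) :
    ¬ Function.Surjective (σ.average s) := by
  intro hsurj
  borelize (Fin d → Circle)
  let μ : Measure (Fin d → Circle) := Measure.haar
  let χ : (Fin d → Circle) → ℂ := fun z => ((z j ^ m : Circle) : ℂ)
  have hχ : Continuous χ := continuous_subtype_val.comp ((continuous_apply j).zpow m)
  have hgι : ∀ g : C^∞⟮I, M; 𝓘(ℝ, ℝ), ℝ⟯, Continuous fun z => g (ι z) := fun g =>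
    g.contMDiff.continuous.comp hι
  let rot : ℝ → Fin d → Circle := fun t i => Circle.exp (t * θ i)
  have hχrot : ∀ t z, χ (rot t * z) = Complex.exp (m * (t * θ j) * Complex.I) * χ z := by
    intro t z
    simp only [χ, rot, Pi.mul_apply, mul_zpow, Circle.coe_mul, Circle.coe_zpow, Circle.coe_exp,
      ← Complex.exp_int_mul]
    push_cast
    ring_nf
  -- the Fourier coefficient of `f ∘ σ_t` is that of `f`, times a phase
  have hshift : ∀ (g : C^∞⟮I, M; 𝓘(ℝ, ℝ), ℝ⟯) (t : ℝ),
      ∫ z, (g (σ.toFlow t (ι z)) : ℂ) * χ z ∂μ =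
        Complex.exp (-(m * (t * θ j)) * Complex.I) * ∫ z, (g (ι z) : ℂ) * χ z ∂μ := by
    intro g t
    have h1 := integral_mul_left_eq_self (μ := μ) (fun z => (g (ι z) : ℂ) * χ z) (rot t)
    rw [← h1, ← integral_const_mul]
    refine integral_congr_ae (Eventually.of_forall fun z => ?_)
    simp only [hχrot, hflow]
    change (g (ι (rot t * z)) : ℂ) * χ z = _
    have h2 : Complex.exp (-(m * (t * θ j)) * Complex.I) * Complex.exp (m * (t * θ j) * Complex.I)
        = 1 := by
      rw [← Complex.exp_add, neg_mul, neg_add_cancel, Complex.exp_zero]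
    linear_combination (-(g (ι (rot t * z)) : ℂ) * χ z) * h2
  have hphase : ∫ u in (0 : ℝ)..1, Complex.exp (-(m * ((u * s : ℝ) * θ j)) * Complex.I) = 0 := by
    have hc : (-(n * (2 * Real.pi)) * Complex.I : ℂ) ≠ 0 := by
      simp [hn, Real.pi_ne_zero]
    have h1 := integral_exp_mul_complex (a := 0) (b := 1) hc
    have h2 : Complex.exp (-(n * (2 * Real.pi)) * Complex.I * (1 : ℝ)) = 1 := by
      rw [Complex.exp_eq_one_iff]
      exact ⟨-n, by push_cast; ring⟩
    rw [h2] at h1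
    simp only [Complex.ofReal_zero, mul_zero, Complex.exp_zero, sub_self, zero_div] at h1
    rw [← h1]
    refine intervalIntegral.integral_congr fun u _ => ?_
    have h3 : (m : ℂ) * (s * θ j) = n * (2 * Real.pi) := by exact_mod_cast hs
    congr 1
    push_cast
    linear_combination (-(u : ℂ) * Complex.I) * h3
  have hzero : ∀ g : C^∞⟮I, M; 𝓘(ℝ, ℝ), ℝ⟯, ∫ z, (σ.average s g (ι z) : ℂ) * χ z ∂μ = 0 := by
    intro g
    have hcont : Continuous fun q : (Fin d → Circle) × ℝ =>
        (g (σ.toFlow (q.2 * s) (ι q.1)) : ℂ) * χ q.1 := by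
      have : Continuous fun q : (Fin d → Circle) × ℝ => g (σ.toFlow (q.2 * s) (ι q.1)) :=
        g.contMDiff.continuous.comp (by fun_prop)
      exact (Complex.continuous_ofReal.comp this).mul (hχ.comp continuous_fst)
    calc ∫ z, (σ.average s g (ι z) : ℂ) * χ z ∂μ
        = ∫ z, (∫ u in (0 : ℝ)..1, (g (σ.toFlow (u * s) (ι z)) : ℂ) * χ z) ∂μ := by
          refine integral_congr_ae (Eventually.of_forall fun z => ?_)
          simp only [average_apply]
          rw [intervalIntegral.integral_mul_const, intervalIntegral.integral_ofReal]
      _ = ∫ u in (0 : ℝ)..1, ∫ z, (g (σ.toFlow (u * s) (ι z)) : ℂ) * χ z ∂μ := by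
          simp only [intervalIntegral.integral_of_le zero_le_one]
          refine integral_integral_swap ?_
          have h1 : Integrable (fun q : (Fin d → Circle) × ℝ =>
              (g (σ.toFlow (q.2 * s) (ι q.1)) : ℂ) * χ q.1)
              ((μ.prod volume).restrict (univ ×ˢ Icc 0 1)) :=
            hcont.continuousOn.integrableOn_compact (isCompact_univ.prod isCompact_Icc)
          rw [← Measure.prod_restrict, Measure.restrict_univ] at h1
          refine h1.mono_measure ?_
          exact Measure.prod_mono le_rfl (Measure.restrict_mono Ioc_subset_Icc_self le_rfl)
      _ = 0 := by
          simp only [hshift]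
          rw [intervalIntegral.integral_mul_const, hphase, zero_mul]
  -- a bump at `ι 1`, supported where the character has positive real part
  let C : Set M := ι '' {z | (χ z).re ≤ 0}
  have hC : IsClosed C :=
    (((isClosed_le (Complex.continuous_re.comp hχ) continuous_const).isCompact).image hι).isClosed
  have h1C : ι 1 ∉ C := by
    rintro ⟨z, hz, hz1⟩
    rw [hinj hz1] at hz
    simp [χ] at hz
    linarith
  obtain ⟨f, hfC, hf1, hf01⟩ := exists_contMDiffMap_zero_one_of_isClosed I (n := (⊤ : ℕ∞)) hC
    (isClosed_singleton (x := ι 1)) (disjoint_singleton_right.2 h1C)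
  obtain ⟨g, hg⟩ := hsurj f
  have h0 := hzero g
  rw [hg] at h0
  have hfχ : Continuous fun z => (f (ι z) : ℂ) * χ z :=
    (Complex.continuous_ofReal.comp (hgι f)).mul hχ
  have hre : ∫ z, f (ι z) * (χ z).re ∂μ = 0 := by
    have h1 := Complex.reCLM.integral_comp_comm
      (hfχ.integrable_of_hasCompactSupport (μ := μ) (HasCompactSupport.of_compactSpace _))
    rw [h0, map_zero] at h1
    rw [← h1]
    refine integral_congr_ae (Eventually.of_forall fun z => ?_)
    simp
  refine (Continuous.integral_pos_of_hasCompactSupport_nonneg_nonzero (μ := μ)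
    (f := fun z => f (ι z) * (χ z).re) (x := 1)
    ((hgι f).mul (Complex.continuous_re.comp hχ)) (HasCompactSupport.of_compactSpace _)
    (fun z => ?_) ?_).ne' hre
  · by_cases hz : (χ z).re ≤ 0
    · simp [hfC ⟨z, hz, rfl⟩]
    · exact mul_nonneg (hf01 _).1 (not_le.1 hz).le
  · simp [hf1 rfl, χ]

theorem dense_setOf_not_surjective_average (h : σ.HasLinearTorusOrbitClosure) :
    Ioi (0 : ℝ) ⊆ closure {s : ℝ | 0 < s ∧ ¬ Function.Surjective (σ.average s)} := by
  obtain ⟨p, d, θ, ι, hd, hι, hinj, hrange, hflow⟩ := h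
  -- the flow is not constant on the torus, as the closure of a fixed point is a single point
  have hθ : ∃ j, θ j ≠ 0 := by
    by_contra! h0
    obtain ⟨z, hz⟩ : p ∈ range ι := hrange ▸ subset_closure (σ.toFlow.mem_orbit_self p)
    have hfix : ∀ t, σ.toFlow t p = p := fun t => by
      rw [← hz, hflow]
      simp [h0]
    have horb : σ.toFlow.orbit p = {p} := by
      rw [Flow.orbit_eq_range]
      simp only [hfix, range_const]
    rw [horb, closure_singleton] at hrange
    have hsub : ∀ z, ι z = p := fun z => by
      have : ι z ∈ range ι := mem_range_self z
      rwa [hrange] at this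
    have h1 := congrFun (hinj ((hsub 1).trans (hsub fun _ => Circle.exp Real.pi).symm)) ⟨0, hd⟩
    have h2 := congrArg ((↑) : Circle → ℂ) h1
    simp [Circle.coe_exp, Complex.exp_pi_mul_I] at h2
    norm_num at h2
  obtain ⟨j, hj⟩ := hθ
  have ha : 0 < 2 * Real.pi / |θ j| := by positivity
  set a := 2 * Real.pi / |θ j| with hadef
  intro x (hx : 0 < x)
  rw [Metric.mem_closure_iff]
  intro ε hε
  -- the times `(n / m) * a` are dense
  obtain ⟨q, hq1, hq2⟩ := exists_rat_btwn (show x / a < (x + ε) / a by gcongr; linarith)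
  have hq0 : 0 < (q : ℝ) := lt_trans (by positivity) hq1
  have hq0' : 0 < q := by exact_mod_cast hq0
  rw [div_lt_iff₀ ha] at hq1
  rw [lt_div_iff₀ ha] at hq2
  refine ⟨q * a, ⟨by positivity, ?_⟩, ?_⟩
  · have hden : (q : ℝ) * q.den = q.num := by exact_mod_cast Rat.mul_den_eq_num q
    rcases abs_cases (θ j) with ⟨h1, -⟩ | ⟨h1, -⟩
    · refine σ.not_surjective_average_of_torus hι hinj hflow (j := j) (m := q.den) (n := q.num)
        (Rat.num_pos.2 hq0').ne' ?_
      rw [hadef, h1, ← hden]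
      push_cast
      field_simp
    · refine σ.not_surjective_average_of_torus hι hinj hflow (j := j) (m := q.den) (n := -q.num)
        (neg_ne_zero.2 (Rat.num_pos.2 hq0').ne') ?_
      rw [hadef, h1]
      push_cast
      rw [← hden]
      field_simp
  · rw [dist_comm, Real.dist_eq, abs_lt]
    constructor <;> linarith

end SmoothFlow

/-! ### Failure of surjectivity and of local exponentiality -/

theorem theorem3p10 {E : Type*} [NormedAddCommGroup E] [NormedSpace ℝ E] [FiniteDimensional ℝ E]
    {H : Type*} [TopologicalSpace H] (I : ModelWithCorners ℝ E H)
    {M : Type*} [TopologicalSpace M] [ChartedSpace H M] [IsManifold I ∞ M]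
    [CompactSpace M] [T2Space M]
    (σ : SmoothFlow I M) (hσ : σ.Nontrivial) :
    (σ.HasNonperiodicLocallyClosedOrbit →
      ∀ᵐ s : ℝ ∂volume, ¬ Function.Surjective (σ.average s)) ∧
    (σ.HasLinearTorusOrbitClosure →
      Ioi (0 : ℝ) ⊆ closure {s : ℝ | 0 < s ∧ ¬ Function.Surjective (σ.average s)}) ∧
    (∃! e, σ.IsExponentialFunction e) ∧
    (σ.HasNonperiodicLocallyClosedOrbit ∨ σ.HasLinearTorusOrbitClosure →
      ∀ e, σ.IsExponentialFunction e → ¬ IsLocalDiffeoAt (fun x => σ.groupChart (e x)) 0) := by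
  refine ⟨σ.ae_not_surjective_average, σ.dense_setOf_not_surjective_average,
    σ.existsUnique_exponentialFunction, fun h e he hdiff => ?_⟩
  rw [σ.eq_expMap he] at hdiff
  obtain ⟨δ, hδ, hsurj⟩ := Metric.eventually_nhds_iff.1
    (σ.eventually_surjective_of_isLocalDiffeoAt hdiff)
  rcases h with h | h
  · obtain ⟨s, hs, hsδ⟩ := (Measure.dense_of_ae (σ.ae_not_surjective_average h)).exists_dist_lt 0 hδ
    exact hs (hsurj (by rwa [dist_comm]))
  · obtain ⟨s, ⟨hs0, hs⟩, hsδ⟩ := Metric.mem_closure_iff.1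
      (σ.dense_setOf_not_surjective_average h (half_pos hδ : δ / 2 ∈ Ioi 0)) (δ / 2) (half_pos hδ)
    refine hs (hsurj ?_)
    rw [Real.dist_eq, abs_lt] at hsδ ⊢
    constructor <;> linarith
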